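/- All graphs are finite and simple. A dominating set of a graph $G$ is a set $D \subseteq V(G)$ such that every vertex of $V(G) \setminus D$ is adjacent to at least one vertex of $D$. The TARS-graph $\varepsilon(G)$ is the graph whose vertices are the dominating sets of $G$, where two dominating sets $X$ and $Y$ are adjacent if and only if either $Y$ can be obtained from $X$ by adding or deleting a single vertex of $G$, or there exist $u \in X$ and $v \in Y \setminus X$ that are adjacent in $G$ such that $Y = (X \cup \{v\}) \setminus \{u\}$. A graph on $n$ vertices is pancyclic if it contains a cycle of length $\ell$ for every integer $\ell$ with $3 \le \ell \le n$. A graph $H'$ is obtained from a graph $H$ by Operation B if $H$ has vertices $u, v, x$ with $u \ne v$ and $N(u) = N(v) = \{x\}$ such that $H' = H - \{v\}$ (up to isomorphism). **Theorem.** Let $H$ and $H'$ be graphs such that $H'$ is obtained from $H$ by Operation B. If $\varepsilon(H')$ is pancyclic, then $\varepsilon(H)$ is pancyclic. -/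

import Mathlib

/-- `D` is a dominating set of `G`: every vertex outside `D` has a neighbour in `D`. -/
def IsDominatingSet {V : Type*} (G : SimpleGraph V) (D : Set V) : Prop :=
  ∀ w, w ∉ D → ∃ d ∈ D, G.Adj w d

/-- `Y` is obtained from `X` by adding or deleting a single vertex. -/
def IsTokenAddRemove {V : Type*} (X Y : Set V) : Prop :=
  (∃ w, w ∉ X ∧ Y = X ∪ {w}) ∨ (∃ w, w ∈ X ∧ Y = X \ {w})

/-- `Y` is obtained from `X` by sliding a token along an edge of `G`. -/
def IsTokenSlide {V : Type*} (G : SimpleGraph V) (X Y : Set V) : Prop :=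
  ∃ u v, u ∈ X ∧ v ∈ Y \ X ∧ G.Adj u v ∧ Y = (X ∪ {v}) \ {u}

theorem IsTokenAddRemove.symm {V : Type*} {X Y : Set V} (h : IsTokenAddRemove X Y) :
    IsTokenAddRemove Y X := by
  rcases h with ⟨w, hw, rfl⟩ | ⟨w, hw, rfl⟩
  · refine Or.inr ⟨w, by simp, ?_⟩
    ext z
    by_cases hz : z = w <;> simp_all
  · refine Or.inl ⟨w, by simp, ?_⟩
    ext z
    by_cases hz : z = w <;> simp_all

theorem IsTokenSlide.symm {V : Type*} {G : SimpleGraph V} {X Y : Set V}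
    (h : IsTokenSlide G X Y) : IsTokenSlide G Y X := by
  obtain ⟨u, v, hu, ⟨hvY, hvX⟩, huv, rfl⟩ := h
  refine ⟨v, u, hvY, ⟨hu, by simp⟩, huv.symm, ?_⟩
  ext z
  by_cases hz : z = u <;> by_cases hz' : z = v <;> simp_all

theorem not_isTokenAddRemove_self {V : Type*} (X : Set V) : ¬ IsTokenAddRemove X X := by
  rintro (⟨w, hw, h⟩ | ⟨w, hw, h⟩)
  · exact hw (h ▸ Or.inr rfl)
  · rw [h] at hw
    exact hw.2 rfl

theorem not_isTokenSlide_self {V : Type*} (G : SimpleGraph V) (X : Set V) :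
    ¬ IsTokenSlide G X X := by
  rintro ⟨_, _, _, hv, _⟩
  exact hv.2 hv.1

/-- The TARS-graph of `G`: its vertices are the dominating sets of `G`, and two of them are
adjacent if they differ by one token addition or removal, or by one token slide. -/
def tarsGraph {V : Type*} (G : SimpleGraph V) :
    SimpleGraph {D : Set V // IsDominatingSet G D} where
  Adj X Y := IsTokenAddRemove X.1 Y.1 ∨ IsTokenSlide G X.1 Y.1
  symm := ⟨fun _ _ h => h.imp IsTokenAddRemove.symm IsTokenSlide.symm⟩
  loopless := ⟨fun X h => h.elim (not_isTokenAddRemove_self X.1) (not_isTokenSlide_self G X.1)⟩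

/-- A finite graph on `n` vertices is pancyclic if it has a cycle of every length
`ℓ` with `3 ≤ ℓ ≤ n`. -/
def IsPancyclic {V : Type*} [Finite V] (G : SimpleGraph V) : Prop :=
  ∀ ℓ : ℕ, 3 ≤ ℓ → ℓ ≤ Nat.card V → ∃ (a : V) (p : G.Walk a a), p.IsCycle ∧ p.length = ℓ

/-- `H'` is obtained from `H` by Operation B: `H` has two distinct leaves `u`, `v` with the same
neighbour `x`, and `H'` is (up to isomorphism) the graph `H - {v}`. -/
def IsOperationB {V W : Type*} (H : SimpleGraph V) (H' : SimpleGraph W) : Prop :=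
  ∃ u v x : V, u ≠ v ∧ H.neighborSet u = {x} ∧ H.neighborSet v = {x} ∧
    Nonempty (H' ≃g H.induce {w | w ≠ v})

/-!
Let `u` and `v` be the twin leaves. The dominating sets of `H` containing `v` induce a copy of
`ε(H')`. All others come in pairs: every dominating set `D` with `v ∈ D` and `u ∉ D` is the base of
a rung, the edge of `ε(H)` joining `(D \ {v}) ∪ {u}` to `D \ {v}`.

Take a cycle in the copy of `ε(H')` and orient it towards a vertex containing `u`. When a base `D`
is followed by `Z`, its rung can be inserted in place of the edge `DZ` if `u ∈ Z`, and in place of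
the rung over `Z` if `u ∉ Z`. The orientation makes these edges distinct, so any number of rungs can
be inserted, each adding `2` to the length. Starting from cycles that contain all, or all but one,
of the `n` vertices of the copy gives all lengths beyond `n`. A base missing from the cycle has its
rung inserted in place of the rung over a neighbouring base `Q`; both arcs of the cycle are then
oriented away from `Q`, so that no other rung competes for this place. Only `n = 3` leaves no room
to miss a vertex, and there the only extra length is `4`.
-/

open SimpleGraph

section CycleSurgery

variable {V : Type*} {G : SimpleGraph V} {a p q : V} {c : G.Walk a a}

theorem exists_isCycle_snd_eq_of_mem_edges (hc : c.IsCycle) (hpq : s(p, q) ∈ c.edges) :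
    ∃ d : G.Walk p p, d.IsCycle ∧ d.snd = q ∧ d.length = c.length ∧
      (∀ w, w ∈ d.support ↔ w ∈ c.support) ∧ ∀ e, e ∈ d.edges ↔ e ∈ c.edges := by
  classical
  have hp : p ∈ c.support := c.fst_mem_support_of_mem_edges hpq
  have hedges (e) : e ∈ (c.rotate p hp).edges ↔ e ∈ c.edges := (c.rotate_edges p hp).perm.mem_iff
  have hadj : q ∈ (c.rotate p hp).toSubgraph.neighborSet p :=
    Walk.adj_toSubgraph_iff_mem_edges.2 ((hedges _).2 hpq)
  rw [(hc.rotate hp).neighborSet_toSubgraph_endpoint] at hadj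
  rcases hadj with rfl | rfl
  · exact ⟨_, hc.rotate hp, rfl, by simp, by simp, hedges⟩
  · exact ⟨_, (hc.rotate hp).reverse, by simp, by simp, by simp, by simpa using hedges⟩

theorem exists_isCycle_replace_edge {y z : V} (hc : c.IsCycle) (hpq : s(p, q) ∈ c.edges)
    (hy : y ∉ c.support) (hz : z ∉ c.support) (hpy : G.Adj p y) (hyz : G.Adj y z)
    (hzq : G.Adj z q) :
    ∃ (b : V) (d : G.Walk b b), d.IsCycle ∧ d.length = c.length + 2 ∧
      (∀ w, w ∈ d.support → w ∈ c.support ∨ w = y ∨ w = z) ∧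
      (∀ e ∈ c.edges, e ≠ s(p, q) → e ∈ d.edges) ∧ s(y, z) ∈ d.edges := by
  obtain ⟨d, hd, rfl, hlen, hsupp, hedges⟩ := exists_isCycle_snd_eq_of_mem_edges hc hpq
  have htail (w) (hw : w ∈ d.tail.support) : w ∈ c.support :=
    (hsupp w).1 (d.support_tail_of_not_nil hd.not_nil ▸ List.mem_of_mem_tail <| hw)
  have hp : p ∈ c.support := htail p d.tail.end_mem_support
  have hy' : y ∉ d.tail.support := fun h => hy (htail y h)
  have hz' : z ∉ d.tail.support := fun h => hz (htail z h)
  have hcons : d.edges = s(p, d.snd) :: d.tail.edges := by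
    conv_lhs => rw [← d.cons_tail_eq hd.not_nil, Walk.edges_cons]
  refine ⟨p, .cons hpy (.cons hyz (.cons hzq d.tail)), ?_, ?_, ?_, ?_, by simp⟩
  · have hpz : p ≠ z := fun h => hz (h ▸ hp)
    have hpy_notMem : s(p, y) ∉ d.edges.tail := fun h =>
      hy (c.snd_mem_support_of_mem_edges ((hedges _).1 (List.mem_of_mem_tail h)))
    simp [Walk.cons_isCycle_iff, hd.isPath_tail, hy', hz', hyz.ne, hpy.ne, hpz, hpy_notMem]
  · have := Walk.length_tail_add_one hd.not_nil
    simp only [Walk.length_cons]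
    omega
  · simp only [Walk.support_cons, List.mem_cons]
    rintro w (rfl | rfl | rfl | hw)
    exacts [.inl hp, .inr (.inl rfl), .inr (.inr rfl), .inl (htail w hw)]
  · intro e he hne
    rw [← hedges, hcons, List.mem_cons] at he
    simp only [Walk.edges_cons, List.mem_cons, he.resolve_left hne, or_true]

theorem ncard_setOf_mem_support_of_isCycle (hc : c.IsCycle) :
    {w | w ∈ c.support}.ncard = c.length := by
  classical
  have : {w | w ∈ c.support} = c.support.tail.toFinset := by
    ext w
    rw [List.coe_toFinset, Set.mem_ofPred_eq, Set.mem_ofPred_eq, ← c.cons_tail_support,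
      List.mem_cons, List.tail_cons, or_iff_right_of_imp]
    exact fun h => h ▸ Walk.end_mem_tail_support hc.not_nil
  rw [this, Set.ncard_coe_finset, List.toFinset_card_of_nodup hc.support_nodup]
  simp

end CycleSurgery

section RungInsertion

variable {V α β : Type*} {G : SimpleGraph V}

theorem exists_isCycle_of_edge_attachment [Finite α] [LinearOrder β] {a : V} {c : G.Walk a a}
    (hc : c.IsCycle) {left right : α → V} (hleft : left.Injective) (hright : right.Injective)
    (hlr : ∀ i j, left i ≠ right j) (hadj : ∀ i, G.Adj (left i) (right i))
    (hleft_notMem : ∀ i, left i ∉ c.support) (hright_notMem : ∀ i, right i ∉ c.support)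
    {edge : α → Sym2 V} (hedge : edge.Injective)
    (hattach : ∀ i, ∃ p q, edge i = s(p, q) ∧ G.Adj p (left i) ∧ G.Adj (right i) q) (rank : α → β)
    (hprev : ∀ i, edge i ∈ c.edges ∨ ∃ j, rank j < rank i ∧ edge i = s(left j, right j))
    {k : ℕ} (hk : k ≤ Nat.card α) :
    ∃ (b : V) (d : G.Walk b b), d.IsCycle ∧ d.length = c.length + 2 * k := by
  induction k generalizing α a with
  | zero => exact ⟨a, c, hc, rfl⟩
  | succ k ih =>
    have : Nonempty α := Finite.card_pos_iff.1 (by omega)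
    obtain ⟨i, hmin⟩ := Finite.exists_min rank
    obtain ⟨p, q, hpq, hp, hq⟩ := hattach i
    have hi : s(p, q) ∈ c.edges :=
      hpq ▸ (hprev i).resolve_right fun ⟨j, hj, _⟩ => (hmin j).not_gt hj
    obtain ⟨b, d, hd, hlen, hsupp, hedges, hrung⟩ :=
      exists_isCycle_replace_edge hc hi (hleft_notMem i) (hright_notMem i) hp (hadj i) hq
    have hne {j} (hj : j ≠ i) : edge j ≠ s(p, q) := hpq ▸ hedge.ne hj
    have hcard : Nat.card {j // j ≠ i} + 1 = Nat.card α := by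
      rw [← Set.ncard_add_ncard_compl {i}, Set.ncard_singleton, add_comm]
      rfl
    have hprev' (j : {j // j ≠ i}) :
        edge j ∈ d.edges ∨ ∃ j' : {j // j ≠ i}, rank j' < rank j ∧
          edge j = s(left j', right j') := by
      obtain h | ⟨j', hlt, hj'⟩ := hprev j
      · exact .inl (hedges _ h (hne j.2))
      · by_cases hji : j' = i
        · exact .inl (hj' ▸ hji ▸ hrung)
        · exact .inr ⟨⟨j', hji⟩, hlt, hj'⟩
    obtain ⟨b', d', hd', hlen'⟩ := ih (α := {j // j ≠ i}) hd
      (hleft.comp Subtype.val_injective) (hright.comp Subtype.val_injective)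
      (fun j j' => hlr j j') (fun j => hadj j)
      (fun j h => (hsupp _ h).elim (hleft_notMem j)
        fun h => h.elim (fun h => j.2 (hleft h)) (hlr j i))
      (fun j h => (hsupp _ h).elim (hright_notMem j)
        fun h => h.elim (fun h => hlr i j h.symm) fun h => j.2 (hright h))
      (hedge.comp Subtype.val_injective) (fun j => hattach j) (fun j => rank j) hprev' (by omega)
    exact ⟨b', d', hd', by omega⟩

end RungInsertion

section CycleOrientation

variable {V : Type*} {G : SimpleGraph V} {a b : V} {c : G.Walk a a}

theorem exists_indexing_of_isCycle (hc : c.IsCycle) (hb : b ∈ c.support) :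
    ∃ (vert : ℕ → V) (index : V → ℕ), vert 0 = b ∧ vert c.length = b ∧
      (∀ i < c.length, index (vert i) = i ∧ s(vert i, vert (i + 1)) ∈ c.edges) ∧
      ∀ w ∈ c.support, index w < c.length ∧ vert (index w) = w := by
  classical
  have hd : (c.rotate b hb).IsCycle := hc.rotate hb
  have hinj : Set.InjOn (c.rotate b hb).getVert {i | i < c.length} := fun i hi j hj h =>
    hd.getVert_injOn' (Nat.le_sub_one_of_lt (by simpa using hi))
      (Nat.le_sub_one_of_lt (by simpa using hj)) h
  have hsurj (w) (hw : w ∈ c.support) : ∃ i < c.length, (c.rotate b hb).getVert i = w := by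
    obtain ⟨i, rfl, hi⟩ := (Walk.mem_support_iff_exists_getVert (p := c.rotate b hb)).1 (by simpa)
    obtain hi | rfl := hi.lt_or_eq
    · exact ⟨i, by simpa using hi, rfl⟩
    · exact ⟨0, by have := hc.three_le_length; omega,
        by rw [Walk.getVert_zero, Walk.getVert_length]⟩
  choose! index hindex using hsurj
  refine ⟨(c.rotate b hb).getVert, index, by simp, ?_, fun i hi => ⟨?_, ?_⟩, hindex⟩
  · simpa using (c.rotate b hb).getVert_length
  · have hmem : (c.rotate b hb).getVert i ∈ c.support :=
      (c.mem_support_rotate_iff b hb).1 ((c.rotate b hb).getVert_mem_support i)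
    exact hinj (hindex _ hmem).1 hi (hindex _ hmem).2
  · exact (c.rotate_edges b hb).perm.mem_iff.1
      (Walk.adj_toSubgraph_iff_mem_edges.1 (Walk.toSubgraph_adj_getVert _ (by simpa)))

theorem exists_step_toward_ends (m n : ℕ) :
    ∃ step rank : ℕ → ℕ, ∀ i, i ≠ 0 → i < n → (step i + 1 = i ∨ step i = i + 1) ∧
      (step i ≠ 0 → step i ≠ n → step i ≠ m ∧ rank (step i) < rank i ∧
        ∀ j, j ≠ 0 → j < n → step i = step j → i = j) := by
  -- Stepping away from `m` on both sides keeps `m` out of the range of `step`.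
  refine ⟨fun i => if i ≤ m then i - 1 else i + 1, fun i => if i ≤ m then i else n - i, ?_⟩
  grind

theorem exists_orientation_of_isCycle (q : V) (hc : c.IsCycle) (hb : b ∈ c.support) :
    ∃ (next : V → V) (rank : V → ℕ), ∀ p ∈ c.support, p ≠ b →
      s(p, next p) ∈ c.edges ∧ (next p ≠ b → next p ≠ q ∧ rank (next p) < rank p ∧
        ∀ p' ∈ c.support, p' ≠ b → next p = next p' → p = p') := by
  obtain ⟨vert, index, hvert_zero, hvert_length, hvert, hindex⟩ := exists_indexing_of_isCycle hc hb
  obtain ⟨step, rank, hstep⟩ := exists_step_toward_ends (index q) c.length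
  have hpos {p} (hp : p ∈ c.support) (hpb : p ≠ b) : index p ≠ 0 := fun h =>
    hpb (by rw [← (hindex p hp).2, h, hvert_zero])
  have index_step {p} (hp : p ∈ c.support) (hpb : p ≠ b) (hne : vert (step (index p)) ≠ b) :
      step (index p) ≠ 0 ∧ step (index p) ≠ c.length ∧
        index (vert (step (index p))) = step (index p) := by
    have hzero : step (index p) ≠ 0 := fun h => hne (h ▸ hvert_zero)
    have hlength : step (index p) ≠ c.length := fun h => hne (h ▸ hvert_length)
    have hlt := (hindex p hp).1
    have hadj := (hstep _ (hpos hp hpb) hlt).1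
    exact ⟨hzero, hlength, (hvert _ (by omega)).1⟩
  refine ⟨fun p => vert (step (index p)), fun p => rank (index p), fun p hp hpb => ?_⟩
  obtain ⟨hlt, hp_eq⟩ := hindex p hp
  obtain ⟨hadj, haway⟩ := hstep _ (hpos hp hpb) hlt
  refine ⟨?_, fun hne => ?_⟩
  · obtain hpred | hsucc := hadj
    · have hmem := (hvert (step (index p)) (by omega)).2
      rwa [hpred, hp_eq, Sym2.eq_swap] at hmem
    · simpa only [hsucc, hp_eq] using (hvert (index p) hlt).2
  · obtain ⟨hzero, hlength, hidx⟩ := index_step hp hpb hne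
    obtain ⟨hne_q, hrank, hinj⟩ := haway hzero hlength
    refine ⟨fun h => hne_q (hidx ▸ congrArg index h), by simpa only [hidx] using hrank,
      fun p' hp' hpb' heq => ?_⟩
    have hidx' := (index_step hp' hpb' fun h => hne (heq.trans h)).2.2
    have heq_index := hinj (index p') (hpos hp' hpb') (hindex p' hp').1
      (by rw [← hidx, ← hidx']; exact congrArg index heq)
    rw [← hp_eq, heq_index, (hindex p' hp').2]

end CycleOrientation

section RungSystem

variable {V α : Type*} {G : SimpleGraph V}

/-- A system of rungs over a set `layer` of vertices of `G`: each rung is an edge joining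
`left i` to `right i` outside the layer, anchored at the vertex `base i`. Rungs over adjacent bases
span a four-cycle, and a layer vertex that is not a base is adjacent to `left i` whenever it is
adjacent to `base i`. These are the adjacencies through which a rung can be inserted into a cycle
that starts out inside the layer. -/
structure RungSystem (G : SimpleGraph V) (α : Type*) where
  layer : Set V
  base : α → V
  left : α → V
  right : α → V
  base_injective : base.Injective
  left_injective : left.Injective
  right_injective : right.Injective
  left_ne_right (i j) : left i ≠ right j
  left_notMem_layer (i) : left i ∉ layer
  right_notMem_layer (i) : right i ∉ layer
  adj_left_right (i) : G.Adj (left i) (right i)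
  adj_right_base (i) : G.Adj (right i) (base i)
  adj_left_left {i j} : G.Adj (base i) (base j) → G.Adj (left i) (left j)
  adj_right_right {i j} : G.Adj (base i) (base j) → G.Adj (right i) (right j)
  adj_left_of_adj_base {z i} :
    z ∈ layer → z ∉ Set.range base → G.Adj z (base i) → G.Adj z (left i)

namespace RungSystem

/-- The edge in whose place the rung over `base i` is inserted: the rung over `parent i` if
`parent i` is itself a base, and the edge from `parent i` to `base i` otherwise. -/
noncomputable def attachmentEdge (R : RungSystem G α) (parent : α → V) (i : α) : Sym2 V :=
  Function.extend R.base (fun j => s(R.left j, R.right j)) (fun z => s(z, R.base i)) (parent i)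

variable (R : RungSystem G α) {parent : α → V} {i j : α}

theorem attachmentEdge_of_eq_base (h : parent i = R.base j) :
    R.attachmentEdge parent i = s(R.left j, R.right j) := by
  simp only [attachmentEdge, h, R.base_injective.extend_apply]

theorem attachmentEdge_of_notMem_range (h : parent i ∉ Set.range R.base) :
    R.attachmentEdge parent i = s(parent i, R.base i) :=
  Function.extend_apply' _ _ _ h

theorem attachmentEdge_injective (hlayer : ∀ i, parent i ∉ Set.range R.base → parent i ∈ R.layer)
    (hinj : ∀ i i' j, parent i = R.base j → parent i' = R.base j → i = i') :
    (R.attachmentEdge parent).Injective := by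
  have rung_ne_edge {i j} (h : parent i ∉ Set.range R.base) :
      s(R.left j, R.right j) ≠ s(parent i, R.base i) := fun heq =>
    (Sym2.eq_iff.1 heq).elim (fun h' => R.left_notMem_layer j (h'.1 ▸ hlayer i h))
      fun h' => R.right_notMem_layer j (h'.2 ▸ hlayer i h)
  intro i i' heq
  by_cases h : parent i ∈ Set.range R.base <;> by_cases h' : parent i' ∈ Set.range R.base
  · obtain ⟨⟨j, hj⟩, j', hj'⟩ := h, h'
    rw [R.attachmentEdge_of_eq_base hj.symm, R.attachmentEdge_of_eq_base hj'.symm,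
      Sym2.eq_iff] at heq
    have hjj' : j = j' := R.left_injective (heq.resolve_right fun h => R.left_ne_right _ _ h.1).1
    exact hinj i i' j hj.symm (hjj' ▸ hj'.symm)
  · obtain ⟨j, hj⟩ := h
    rw [R.attachmentEdge_of_eq_base hj.symm, R.attachmentEdge_of_notMem_range h'] at heq
    exact absurd heq (rung_ne_edge h')
  · obtain ⟨j', hj'⟩ := h'
    rw [R.attachmentEdge_of_eq_base hj'.symm, R.attachmentEdge_of_notMem_range h] at heq
    exact absurd heq.symm (rung_ne_edge h)
  · rw [R.attachmentEdge_of_notMem_range h, R.attachmentEdge_of_notMem_range h',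
      Sym2.eq_iff] at heq
    exact R.base_injective (heq.resolve_right fun heq => h ⟨i', heq.1.symm⟩).2

variable [Finite α] {a b q : V} {c : G.Walk a a} {k : ℕ}

theorem exists_isCycle_of_parent {β : Type*} [LinearOrder β] (hc : c.IsCycle)
    (hlayer : ∀ w ∈ c.support, w ∈ R.layer) (rank : α → β)
    (hedge : ∀ i, parent i ∉ Set.range R.base → s(parent i, R.base i) ∈ c.edges)
    (hbase : ∀ i j, parent i = R.base j → G.Adj (R.base j) (R.base i) ∧ rank j < rank i)
    (hinj : ∀ i i' j, parent i = R.base j → parent i' = R.base j → i = i')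
    (hk : k ≤ Nat.card α) :
    ∃ (b : V) (d : G.Walk b b), d.IsCycle ∧ d.length = c.length + 2 * k := by
  have hparent_layer (i) (h : parent i ∉ Set.range R.base) : parent i ∈ R.layer :=
    hlayer _ (c.fst_mem_support_of_mem_edges (hedge i h))
  refine exists_isCycle_of_edge_attachment hc R.left_injective R.right_injective R.left_ne_right
    R.adj_left_right (fun i h => R.left_notMem_layer i (hlayer _ h))
    (fun i h => R.right_notMem_layer i (hlayer _ h))
    (R.attachmentEdge_injective hparent_layer hinj) (fun i => ?_) rank (fun i => ?_) hk
  · by_cases h : parent i ∈ Set.range R.base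
    · obtain ⟨j, hj⟩ := h
      have hadj := (hbase i j hj.symm).1
      exact ⟨_, _, R.attachmentEdge_of_eq_base hj.symm, R.adj_left_left hadj,
        R.adj_right_right hadj.symm⟩
    · exact ⟨_, _, R.attachmentEdge_of_notMem_range h, R.adj_left_of_adj_base (hparent_layer i h) h
        (c.adj_of_mem_edges (hedge i h)), R.adj_right_base i⟩
  · by_cases h : parent i ∈ Set.range R.base
    · obtain ⟨j, hj⟩ := h
      exact .inr ⟨j, (hbase i j hj.symm).2, R.attachmentEdge_of_eq_base hj.symm⟩
    · exact .inl (R.attachmentEdge_of_notMem_range h ▸ hedge i h)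

theorem exists_isCycle_length_add_two_mul_of_anchor (hc : c.IsCycle)
    (hlayer : ∀ w ∈ c.support, w ∈ R.layer) (hb : b ∈ c.support) (hb_base : b ∉ Set.range R.base)
    (hmissing : {i | R.base i ∉ c.support}.Subsingleton) (hq : q ∈ c.support)
    (hanchor : ∀ i, R.base i ∉ c.support → q ∈ Set.range R.base ∧ G.Adj q (R.base i))
    (hk : k ≤ Nat.card α) :
    ∃ (b : V) (d : G.Walk b b), d.IsCycle ∧ d.length = c.length + 2 * k := by
  classical
  obtain ⟨next, rank, hnext⟩ := exists_orientation_of_isCycle q hc hb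
  have ne_b (i) : R.base i ≠ b := fun h => hb_base ⟨i, h⟩
  -- A base missing from the cycle hangs on the rung over `q`, which the orientation leaves free.
  refine R.exists_isCycle_of_parent hc hlayer
    (parent := fun i => if R.base i ∈ c.support then next (R.base i) else q)
    (fun i => if R.base i ∈ c.support then (rank (R.base i) : WithTop ℕ) else ⊤) ?_ ?_ ?_ hk
  · intro i h
    split_ifs at h ⊢ with hi
    · exact Sym2.eq_swap ▸ (hnext _ hi (ne_b i)).1
    · exact absurd (hanchor i hi).1 h
  · intro i j h
    split_ifs at h with hi
    · obtain ⟨hmem, hforward⟩ := hnext _ hi (ne_b i)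
      rw [h] at hmem hforward
      have hj := c.snd_mem_support_of_mem_edges hmem
      rw [if_pos hi, if_pos hj]
      exact ⟨(c.adj_of_mem_edges hmem).symm, mod_cast (hforward (ne_b j)).2.1⟩
    · rw [if_neg hi, if_pos (h ▸ hq)]
      exact ⟨h ▸ (hanchor i hi).2, WithTop.coe_lt_top _⟩
  · intro i i' j h h'
    have hforward {i} (hi : R.base i ∈ c.support) (h : next (R.base i) = R.base j) :=
      (hnext _ hi (ne_b i)).2 (h ▸ ne_b j)
    split_ifs at h h' with hi hi' hi'
    · exact R.base_injective ((hforward hi h).2.2 _ hi' (ne_b i') (h.trans h'.symm))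
    · exact absurd (h.trans h'.symm) (hforward hi h).1
    · exact absurd (h'.trans h.symm) (hforward hi' h').1
    · exact hmissing hi hi'

theorem exists_isCycle_length_add_two_mul (hc : c.IsCycle)
    (hlayer : ∀ w ∈ c.support, w ∈ R.layer) (hb : b ∈ c.support) (hb_base : b ∉ Set.range R.base)
    (hmissing : {i | R.base i ∉ c.support}.Subsingleton)
    (hneighbor : ∀ i, R.base i ∉ c.support →
      ∃ j, R.base j ∈ c.support ∧ G.Adj (R.base j) (R.base i))
    (hk : k ≤ Nat.card α) :
    ∃ (b : V) (d : G.Walk b b), d.IsCycle ∧ d.length = c.length + 2 * k := by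
  by_cases h : ∃ i, R.base i ∉ c.support
  · obtain ⟨i, hi⟩ := h
    obtain ⟨j, hj, hadj⟩ := hneighbor i hi
    exact R.exists_isCycle_length_add_two_mul_of_anchor hc hlayer hb hb_base hmissing hj
      (fun i' hi' => ⟨⟨j, rfl⟩, hmissing hi hi' ▸ hadj⟩) hk
  · exact R.exists_isCycle_length_add_two_mul_of_anchor hc hlayer hb hb_base hmissing hb
      (fun i hi => absurd ⟨i, hi⟩ h) hk

end RungSystem

end RungSystem

section TarsGraph

variable {V W : Type*} {G : SimpleGraph V} {G' : SimpleGraph W}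

theorem IsDominatingSet.mono {C D : Set V} (hC : IsDominatingSet G C) (hCD : C ⊆ D) :
    IsDominatingSet G D := fun w hw =>
  let ⟨d, hd, hwd⟩ := hC w fun h => hw (hCD h)
  ⟨d, hCD hd, hwd⟩

theorem isDominatingSet_univ (G : SimpleGraph V) : IsDominatingSet G Set.univ :=
  fun w hw => absurd (Set.mem_univ w) hw

theorem tarsGraph_adj_iff {C D : {D : Set V // IsDominatingSet G D}} :
    (tarsGraph G).Adj C D ↔
      (∃ w, C.1 \ D.1 = ∅ ∧ D.1 \ C.1 = {w}) ∨ (∃ w, C.1 \ D.1 = {w} ∧ D.1 \ C.1 = ∅) ∨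
        ∃ a b, G.Adj a b ∧ C.1 \ D.1 = {a} ∧ D.1 \ C.1 = {b} := by
  have hadd (w : V) : w ∉ C.1 ∧ D.1 = C.1 ∪ {w} ↔ C.1 \ D.1 = ∅ ∧ D.1 \ C.1 = {w} := by
    simp only [Set.ext_iff, Set.mem_union, Set.mem_sdiff, Set.mem_singleton_iff,
      Set.mem_empty_iff_false]
    grind
  have hremove (w : V) : w ∈ C.1 ∧ D.1 = C.1 \ {w} ↔ C.1 \ D.1 = {w} ∧ D.1 \ C.1 = ∅ := by
    simp only [Set.ext_iff, Set.mem_sdiff, Set.mem_singleton_iff, Set.mem_empty_iff_false]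
    grind
  have hslide (a b : V) : a ∈ C.1 ∧ b ∈ D.1 \ C.1 ∧ G.Adj a b ∧ D.1 = (C.1 ∪ {b}) \ {a} ↔
      G.Adj a b ∧ C.1 \ D.1 = {a} ∧ D.1 \ C.1 = {b} := by
    simp only [Set.ext_iff, Set.mem_union, Set.mem_sdiff, Set.mem_singleton_iff]
    grind
  simp only [tarsGraph, IsTokenAddRemove, IsTokenSlide, hadd, hremove, hslide, or_assoc]

theorem tarsGraph_adj_insert {w : V} {C D : {D : Set V // IsDominatingSet G D}} (hw : w ∉ C.1)
    (hD : D.1 = insert w C.1) : (tarsGraph G).Adj C D :=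
  .inl (.inl ⟨w, hw, by rw [hD, Set.union_singleton]⟩)

theorem tarsGraph_adj_iff_of_image_sdiff (f : G ↪g G')
    {C D : {D : Set V // IsDominatingSet G D}} {C' D' : {D : Set W // IsDominatingSet G' D}}
    (hCD : C'.1 \ D'.1 = f '' (C.1 \ D.1)) (hDC : D'.1 \ C'.1 = f '' (D.1 \ C.1)) :
    (tarsGraph G').Adj C' D' ↔ (tarsGraph G).Adj C D := by
  have image_eq_singleton {S : Set V} {b : W} : f '' S = {b} ↔ ∃ a, S = {a} ∧ f a = b := by
    refine ⟨fun h => ?_, by rintro ⟨a, rfl, rfl⟩; exact Set.image_singleton⟩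
    obtain ⟨a, -, rfl⟩ : b ∈ f '' S := h ▸ rfl
    exact ⟨a, f.injective.image_injective (h.trans Set.image_singleton.symm), rfl⟩
  simp only [tarsGraph_adj_iff, hCD, hDC, Set.image_eq_empty, image_eq_singleton]
  simp

theorem tarsGraph_adj_iff_of_sdiff_eq {C D C' D' : {D : Set V // IsDominatingSet G D}}
    (hCD : C'.1 \ D'.1 = C.1 \ D.1) (hDC : D'.1 \ C'.1 = D.1 \ C.1) :
    (tarsGraph G).Adj C' D' ↔ (tarsGraph G).Adj C D := by
  rw [tarsGraph_adj_iff, tarsGraph_adj_iff, hCD, hDC]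

theorem exists_tarsGraph_adj_between {C D : {D : Set V // IsDominatingSet G D}} (hCD : C ≠ D) :
    ∃ E, (tarsGraph G).Adj E C ∧ C.1 ∩ D.1 ⊆ E.1 ∧ E.1 ⊆ C.1 ∪ D.1 := by
  by_cases hDC : D.1 ⊆ C.1
  · obtain ⟨w, hwC, hwD⟩ :=
      Set.exists_of_ssubset (hDC.ssubset_of_ne fun h => hCD (Subtype.ext h.symm))
    have hD : D.1 ⊆ C.1 \ {w} := Set.subset_sdiff_singleton hDC hwD
    exact ⟨⟨C.1 \ {w}, D.2.mono hD⟩, tarsGraph_adj_insert (fun h => h.2 rfl)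
      (Set.insert_sdiff_self_of_mem hwC).symm, Set.inter_subset_right.trans hD,
      Set.sdiff_subset.trans Set.subset_union_left⟩
  · obtain ⟨w, hwD, hwC⟩ := Set.not_subset.1 hDC
    exact ⟨⟨insert w C.1, C.2.mono (Set.subset_insert w C.1)⟩, (tarsGraph_adj_insert hwC rfl).symm,
      Set.inter_subset_left.trans (Set.subset_insert w C.1),
      Set.insert_subset (.inr hwD) Set.subset_union_left⟩

theorem exists_isCycle_length_four_tarsGraph {D : Set V} (hD : IsDominatingSet G D) {a b : V}
    (hab : a ≠ b) (ha : a ∉ D) (hb : b ∉ D) :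
    ∃ (X : {D : Set V // IsDominatingSet G D}) (c : (tarsGraph G).Walk X X),
      c.IsCycle ∧ c.length = 4 := by
  let D₀ : {D : Set V // IsDominatingSet G D} := ⟨D, hD⟩
  let D₁ : {D : Set V // IsDominatingSet G D} := ⟨insert a D, hD.mono (Set.subset_insert a D)⟩
  let D₂ : {D : Set V // IsDominatingSet G D} :=
    ⟨insert b (insert a D), D₁.2.mono (Set.subset_insert b _)⟩
  let D₃ : {D : Set V // IsDominatingSet G D} := ⟨insert b D, hD.mono (Set.subset_insert b D)⟩
  have h₀₁ : (tarsGraph G).Adj D₀ D₁ := tarsGraph_adj_insert ha rfl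
  have h₁₂ : (tarsGraph G).Adj D₁ D₂ := tarsGraph_adj_insert (by simp [D₁, hab.symm, hb]) rfl
  have h₂₃ : (tarsGraph G).Adj D₂ D₃ :=
    (tarsGraph_adj_insert (by simp [D₃, hab, ha]) (Set.insert_comm b a D)).symm
  have h₃₀ : (tarsGraph G).Adj D₃ D₀ := (tarsGraph_adj_insert hb rfl).symm
  refine ⟨D₀, .cons h₀₁ (.cons h₁₂ (.cons h₂₃ (.cons h₃₀ .nil))), ?_, rfl⟩
  have h₀₂ : D₀ ≠ D₂ := fun h =>
    ha (Set.ext_iff.1 (congrArg Subtype.val h) a |>.2 (.inr (.inl rfl)))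
  have h₁₃ : D₁ ≠ D₃ := fun h =>
    (Set.ext_iff.1 (congrArg Subtype.val h) a |>.1 (.inl rfl)).elim hab ha
  simp [Walk.cons_isCycle_iff, h₀₁.ne, h₁₂.ne, h₂₃.ne, h₃₀.ne, h₀₁.ne', h₃₀.ne', h₀₂, h₀₂.symm, h₁₃]

end TarsGraph

section PancyclicEmbedding

theorem IsPancyclic.exists_isCycle_of_embedding {V W : Type*} [Finite V] {G : SimpleGraph V}
    {G' : SimpleGraph W} (hG : IsPancyclic G) (φ : G ↪g G') {ℓ : ℕ} (hℓ : 3 ≤ ℓ)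
    (hcard : ℓ ≤ Nat.card V) :
    ∃ (a : W) (c : G'.Walk a a), c.IsCycle ∧ c.length = ℓ ∧ ∀ w ∈ c.support, w ∈ Set.range φ := by
  obtain ⟨a, c, hc, rfl⟩ := hG ℓ hℓ hcard
  refine ⟨_, c.map φ.toHom, hc.map φ.injective, c.length_map _, fun w hw => ?_⟩
  rw [Walk.support_map, List.mem_map] at hw
  obtain ⟨w', -, rfl⟩ := hw
  exact ⟨w', rfl⟩

end PancyclicEmbedding

section Leaf

variable {V : Type*} {G : SimpleGraph V} {D : Set V} {v w x : V}

theorem IsDominatingSet.compl_singleton (hxw : G.Adj x w) : IsDominatingSet G {x}ᶜ := by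
  intro z hz
  rw [Set.notMem_compl_iff, Set.mem_singleton_iff] at hz
  exact ⟨w, hxw.ne', hz ▸ hxw⟩

theorem adj_iff_of_neighborSet_eq_singleton (hv : G.neighborSet v = {x}) :
    G.Adj v w ↔ w = x := by
  rw [← mem_neighborSet, hv, Set.mem_singleton_iff]

theorem IsDominatingSet.mem_of_notMem_leaf (hD : IsDominatingSet G D)
    (hv : G.neighborSet v = {x}) (hvD : v ∉ D) : x ∈ D := by
  obtain ⟨d, hd, hvd⟩ := hD v hvD
  exact (adj_iff_of_neighborSet_eq_singleton hv).1 hvd ▸ hd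

theorem IsDominatingSet.sdiff_leaf (hD : IsDominatingSet G D) (hv : G.neighborSet v = {x})
    (hx : x ∈ D) : IsDominatingSet G (D \ {v}) := by
  have adj_leaf {w} : G.Adj v w ↔ w = x := adj_iff_of_neighborSet_eq_singleton hv
  intro w hw
  by_cases hwv : w = v
  · exact ⟨x, ⟨hx, (adj_leaf.2 rfl).ne'⟩, hwv ▸ adj_leaf.2 rfl⟩
  · have hwD : w ∉ D := fun hwD => hw ⟨hwD, hwv⟩
    obtain ⟨d, hd, hwd⟩ := hD w hwD
    exact ⟨d, ⟨hd, fun hdv => hwD (adj_leaf.1 (hdv ▸ hwd.symm) ▸ hx)⟩, hwd⟩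

end Leaf

section SetDifference

variable {α : Type*} {s t : Set α} {a b : α}

theorem sdiff_singleton_sdiff_sdiff_singleton (hb : b ∈ t) : (s \ {b}) \ (t \ {b}) = s \ t := by
  ext c
  simp only [Set.mem_sdiff, Set.mem_singleton_iff]
  grind

theorem insert_sdiff_singleton_sdiff (hb : b ∈ t) (ha : a ∉ s) :
    insert a (s \ {b}) \ insert a (t \ {b}) = s \ t := by
  ext c
  simp only [Set.mem_insert_iff, Set.mem_sdiff, Set.mem_singleton_iff]
  grind

end SetDifference

section TwinLeaves

variable {V W : Type*} {G : SimpleGraph V} {G' : SimpleGraph W} {u v x : V}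

/-- The dominating sets containing `v`, as a set of vertices of `tarsGraph G`. -/
def dominatingSetsContaining (G : SimpleGraph V) (v : V) : Set {D : Set V // IsDominatingSet G D} :=
  {D | v ∈ D.1}

/-- The dominating sets containing `v` but not `u`, as a set of vertices of `tarsGraph G`. -/
def dominatingSetsSeparating (G : SimpleGraph V) (v u : V) :
    Set {D : Set V // IsDominatingSet G D} :=
  {D | v ∈ D.1 ∧ u ∉ D.1}

theorem notMem_image_of_range_eq_compl {f : W → V} (hf : Set.range f = {v}ᶜ) (S : Set W) :
    v ∉ f '' S := fun hv =>
  (hf ▸ Set.image_subset_range f S hv : v ∈ ({v}ᶜ : Set V)) rfl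

/-- The embedding `D ↦ D ∪ {v}` of TARS-graphs, where `f` identifies `G'` with `G - v`. -/
def tarsGraphEmbedding (f : G' ↪g G) (hf : Set.range f = {v}ᶜ) : tarsGraph G' ↪g tarsGraph G where
  toFun D := ⟨insert v (f '' D.1), fun w hw => by
    obtain ⟨hwv, hwD⟩ := not_or.1 hw
    obtain ⟨w, rfl⟩ : w ∈ Set.range f := hf ▸ hwv
    obtain ⟨d, hd, hwd⟩ := D.2 w fun hwD' => hwD ⟨w, hwD', rfl⟩
    exact ⟨f d, .inr ⟨d, hd, rfl⟩, f.map_adj_iff.2 hwd⟩⟩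
  inj' C D hCD := by
    refine Subtype.ext (f.injective.image_injective ?_)
    rw [← Set.insert_sdiff_self_of_notMem (notMem_image_of_range_eq_compl hf C.1),
      show insert v (f '' C.1) = insert v (f '' D.1) from congrArg Subtype.val hCD,
      Set.insert_sdiff_self_of_notMem (notMem_image_of_range_eq_compl hf D.1)]
  map_rel_iff' {C D} := by
    have insert_sdiff_insert (S T : Set W) :
        insert v (f '' S) \ insert v (f '' T) = f '' (S \ T) := by
      rw [Set.insert_sdiff_of_mem _ (Set.mem_insert v _), ← Set.union_singleton, ← Set.sdiff_sdiff,
        ← Set.image_sdiff f.injective, Set.sdiff_singleton_eq_self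
          (notMem_image_of_range_eq_compl hf _)]
    exact tarsGraph_adj_iff_of_image_sdiff f (insert_sdiff_insert _ _) (insert_sdiff_insert _ _)

/-- `u` and `v` are distinct leaves of `G` with the same neighbour `x`: the configuration that
Operation B requires. -/
structure IsTwinLeaves (G : SimpleGraph V) (u v x : V) : Prop where
  ne : u ≠ v
  neighborSet_left : G.neighborSet u = {x}
  neighborSet_right : G.neighborSet v = {x}

namespace IsTwinLeaves

theorem adj_left_iff (h : IsTwinLeaves G u v x) {w : V} : G.Adj u w ↔ w = x :=
  adj_iff_of_neighborSet_eq_singleton h.neighborSet_left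

theorem adj_right_iff (h : IsTwinLeaves G u v x) {w : V} : G.Adj v w ↔ w = x :=
  adj_iff_of_neighborSet_eq_singleton h.neighborSet_right

theorem isDominatingSet_sdiff_right (h : IsTwinLeaves G u v x) {D : Set V}
    (hD : IsDominatingSet G D) (hu : u ∉ D) : IsDominatingSet G (D \ {v}) :=
  hD.sdiff_leaf h.neighborSet_right (hD.mem_of_notMem_leaf h.neighborSet_left hu)

theorem tarsGraph_adj_of_eq_insert_sdiff (h : IsTwinLeaves G u v x)
    {C D E : {D : Set V // IsDominatingSet G D}} (hvC : v ∈ C.1) (huC : u ∈ C.1)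
    (hvD : v ∈ D.1) (huD : u ∉ D.1) (hE : E.1 = insert u (D.1 \ {v}))
    (hCD : (tarsGraph G).Adj C D) : (tarsGraph G).Adj C E := by
  have huCD : u ∈ C.1 \ D.1 := ⟨huC, huD⟩
  obtain ⟨w, hempty, -⟩ | ⟨w, hw, hempty⟩ | ⟨a, b, hab, ha, hb⟩ := tarsGraph_adj_iff.1 hCD
  · exact (hempty ▸ huCD : u ∈ (∅ : Set V)).elim
  · obtain rfl : u = w := Set.mem_singleton_iff.1 (hw ▸ huCD)
    have hCE : C.1 = insert v E.1 := by
      simp only [Set.ext_iff, Set.mem_sdiff, Set.mem_singleton_iff,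
        Set.mem_empty_iff_false] at hw hempty
      ext z
      simp only [hE, Set.mem_insert_iff, Set.mem_sdiff, Set.mem_singleton_iff]
      grind
    exact (tarsGraph_adj_insert (by simp [hE, h.ne.symm]) hCE).symm
  · obtain rfl : u = a := Set.mem_singleton_iff.1 (ha ▸ huCD)
    obtain rfl := h.adj_left_iff.1 hab
    have hCE : C.1 \ E.1 = {v} := by
      simp only [Set.ext_iff, hE, Set.mem_insert_iff, Set.mem_sdiff, Set.mem_singleton_iff] at ha ⊢
      grind
    have hEC : E.1 \ C.1 = {b} := by
      simp only [Set.ext_iff, hE, Set.mem_insert_iff, Set.mem_sdiff, Set.mem_singleton_iff] at hb ⊢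
      grind
    exact tarsGraph_adj_iff.2 (.inr (.inr ⟨v, b, h.adj_right_iff.2 rfl, hCE, hEC⟩))

/-- The rungs over the layer of dominating sets containing the leaf `v`: the base `D` separates `v`
from its twin `u`, and its rung joins `(D \ {v}) ∪ {u}` to `D \ {v}`. -/
def rungSystem (h : IsTwinLeaves G u v x) :
    RungSystem (tarsGraph G) (dominatingSetsSeparating G v u) where
  layer := dominatingSetsContaining G v
  base D := D.1
  left D := ⟨insert u (D.1.1 \ {v}),
    (h.isDominatingSet_sdiff_right D.1.2 D.2.2).mono (Set.subset_insert u _)⟩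
  right D := ⟨D.1.1 \ {v}, h.isDominatingSet_sdiff_right D.1.2 D.2.2⟩
  base_injective := Subtype.val_injective
  left_injective C D hCD := by
    refine Subtype.ext (Subtype.ext (subset_antisymm ?_ ?_)) <;> rw [← Set.sdiff_eq_empty]
    · rw [← insert_sdiff_singleton_sdiff D.2.1 C.2.2, Set.sdiff_eq_empty]
      exact (congrArg Subtype.val hCD).subset
    · rw [← insert_sdiff_singleton_sdiff C.2.1 D.2.2, Set.sdiff_eq_empty]
      exact (congrArg Subtype.val hCD).superset
  right_injective C D hCD := by
    refine Subtype.ext (Subtype.ext ?_)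
    rw [← Set.insert_sdiff_self_of_mem C.2.1, ← Set.insert_sdiff_self_of_mem D.2.1]
    exact congrArg (insert v) (congrArg Subtype.val hCD)
  left_ne_right C D hCD := D.2.2 (Set.ext_iff.1 (congrArg Subtype.val hCD) u |>.1 (.inl rfl)).1
  left_notMem_layer D hD := hD.elim h.ne.symm fun hv => hv.2 rfl
  right_notMem_layer D hD := hD.2 rfl
  adj_left_right D := (tarsGraph_adj_insert (fun hu => D.2.2 (Set.mem_of_mem_sdiff hu)) rfl).symm
  adj_right_base D :=
    tarsGraph_adj_insert (fun hv => hv.2 rfl) (Set.insert_sdiff_self_of_mem D.2.1).symm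
  adj_left_left {C D} := (tarsGraph_adj_iff_of_sdiff_eq
    (insert_sdiff_singleton_sdiff D.2.1 C.2.2) (insert_sdiff_singleton_sdiff C.2.1 D.2.2)).2
  adj_right_right {C D} := (tarsGraph_adj_iff_of_sdiff_eq
    (sdiff_singleton_sdiff_sdiff_singleton D.2.1) (sdiff_singleton_sdiff_sdiff_singleton C.2.1)).2
  adj_left_of_adj_base {C D} hC hC_base hCD :=
    h.tarsGraph_adj_of_eq_insert_sdiff hC (by_contra fun hu => hC_base ⟨⟨C, hC, hu⟩, rfl⟩)
      D.2.1 D.2.2 rfl hCD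

theorem range_tarsGraphEmbedding (h : IsTwinLeaves G u v x) (f : G' ↪g G)
    (hf : Set.range f = {v}ᶜ) :
    Set.range (tarsGraphEmbedding f hf) = dominatingSetsContaining G v := by
  refine Set.Subset.antisymm (Set.range_subset_iff.2 fun D => Set.mem_insert v (f '' D.1)) ?_
  intro D (hvD : v ∈ D.1)
  have mem_range {w} (hw : w ≠ v) : w ∈ Set.range f := hf ▸ hw
  have hpreimage : IsDominatingSet G' (f ⁻¹' D.1) := by
    intro w hw
    obtain ⟨d, hd, hwd⟩ := D.2 (f w) hw
    by_cases hdv : d = v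
    · obtain rfl : f w = x := h.adj_right_iff.1 (hdv ▸ hwd.symm)
      have huD : u ∈ D.1 := by_contra fun hu => hw (D.2.mem_of_notMem_leaf h.neighborSet_left hu)
      obtain ⟨u', rfl⟩ := mem_range h.ne
      exact ⟨u', huD, f.map_adj_iff.1 (h.adj_left_iff.2 rfl).symm⟩
    · obtain ⟨d', rfl⟩ := mem_range hdv
      exact ⟨d', hd, f.map_adj_iff.1 hwd⟩
  refine ⟨⟨f ⁻¹' D.1, hpreimage⟩, Subtype.ext ?_⟩
  change insert v (f '' (f ⁻¹' D.1)) = D.1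
  rw [Set.image_preimage_eq_inter_range, hf, ← Set.sdiff_eq, Set.insert_sdiff_self_of_mem hvD]

theorem compl_singleton_left_mem_separating (h : IsTwinLeaves G u v x) :
    ⟨{u}ᶜ, .compl_singleton (h.adj_left_iff.2 rfl)⟩ ∈ dominatingSetsSeparating G v u :=
  ⟨h.ne.symm, fun hu => hu rfl⟩

section Counting

variable [Finite V]

theorem card_le_ncard_containing_add (h : IsTwinLeaves G u v x) :
    Nat.card {D : Set V // IsDominatingSet G D} ≤
      (dominatingSetsContaining G v).ncard + 2 * (dominatingSetsSeparating G v u).ncard := by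
  have ncard_range_le (g : dominatingSetsSeparating G v u → {D : Set V // IsDominatingSet G D}) :
      (Set.range g).ncard ≤ (dominatingSetsSeparating G v u).ncard := by
    rw [← Set.image_univ, ← Nat.card_coe_set_eq (dominatingSetsSeparating G v u), ← Set.ncard_univ]
    exact Set.ncard_image_le
  have hcover : Set.univ ⊆ dominatingSetsContaining G v ∪
      (Set.range h.rungSystem.left ∪ Set.range h.rungSystem.right) := by
    intro D _
    by_cases hv : v ∈ D.1
    · exact .inl hv
    by_cases hu : u ∈ D.1
    · have hD : IsDominatingSet G (D.1 \ {u}) :=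
        D.2.sdiff_leaf h.neighborSet_left (D.2.mem_of_notMem_leaf h.neighborSet_right hv)
      refine .inr (.inl ⟨⟨⟨insert v (D.1 \ {u}), hD.mono (Set.subset_insert v _)⟩,
        .inl rfl, by simp [h.ne]⟩, Subtype.ext ?_⟩)
      change insert u (insert v (D.1 \ {u}) \ {v}) = D.1
      rw [Set.insert_sdiff_self_of_notMem (fun h => hv h.1), Set.insert_sdiff_self_of_mem hu]
    · refine .inr (.inr ⟨⟨⟨insert v D.1, D.2.mono (Set.subset_insert v _)⟩,
        .inl rfl, by simp [h.ne, hu]⟩, Subtype.ext ?_⟩)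
      exact Set.insert_sdiff_self_of_notMem hv
  calc Nat.card {D : Set V // IsDominatingSet G D}
      ≤ (dominatingSetsContaining G v).ncard + ((Set.range h.rungSystem.left).ncard +
          (Set.range h.rungSystem.right).ncard) := by
        rw [← Set.ncard_univ]
        exact (Set.ncard_le_ncard hcover).trans ((Set.ncard_union_le _ _).trans
          (Nat.add_le_add_left (Set.ncard_union_le _ _) _))
    _ ≤ _ := by
        have := ncard_range_le h.rungSystem.left
        have := ncard_range_le h.rungSystem.right
        omega

theorem two_mul_ncard_separating_lt (h : IsTwinLeaves G u v x) :
    2 * (dominatingSetsSeparating G v u).ncard < (dominatingSetsContaining G v).ncard := by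
  let addLeft (D : {D : Set V // IsDominatingSet G D}) : {D : Set V // IsDominatingSet G D} :=
    ⟨insert u D.1, D.2.mono (Set.subset_insert u _)⟩
  have hinj : Set.InjOn addLeft (dominatingSetsSeparating G v u) := by
    intro C hC D hD hCD
    refine Subtype.ext (Set.ext fun w => ?_)
    have hw := Set.ext_iff.1 (congrArg Subtype.val hCD) w
    have := hC.2
    have := hD.2
    simp only [addLeft, Set.mem_insert_iff] at hw
    grind
  have hsubset : dominatingSetsSeparating G v u ⊆ dominatingSetsContaining G v := fun D hD => hD.1
  have hssubset : addLeft '' dominatingSetsSeparating G v u ⊂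
      dominatingSetsContaining G v \ dominatingSetsSeparating G v u := by
    refine Set.ssubset_iff_exists.2 ⟨?_, ⟨{x}ᶜ, .compl_singleton (h.adj_left_iff.2 rfl).symm⟩,
      ⟨(h.adj_right_iff.2 rfl).ne, fun hx => hx.2 (h.adj_left_iff.2 rfl).ne⟩, ?_⟩
    · rintro _ ⟨D, hD, rfl⟩
      exact ⟨.inr hD.1, fun hu => hu.2 (Set.mem_insert u _)⟩
    · rintro ⟨D, hD, heq⟩
      have hx : x ∈ insert u D.1 := .inr (D.2.mem_of_notMem_leaf h.neighborSet_left hD.2)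
      exact (Set.ext_iff.1 (congrArg Subtype.val heq) x).1 hx rfl
  have := Set.ncard_lt_ncard hssubset
  rw [hinj.ncard_image, Set.ncard_sdiff hsubset] at this
  omega

theorem ncard_containing_le_three (h : IsTwinLeaves G u v x)
    (hsub : (dominatingSetsSeparating G v u).Subsingleton) :
    (dominatingSetsContaining G v).ncard ≤ 3 := by
  have hsubset : Subtype.val '' dominatingSetsContaining G v ⊆ {{u}ᶜ, {x}ᶜ, Set.univ} := by
    rintro _ ⟨D, hvD, rfl⟩
    have hE : IsDominatingSet G (insert x D.1 \ {u}) :=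
      (D.2.mono (Set.subset_insert x _)).sdiff_leaf h.neighborSet_left (Set.mem_insert x _)
    have hcompl : insert x D.1 \ {u} = {u}ᶜ := congrArg Subtype.val <|
      hsub (x := ⟨_, hE⟩) ⟨⟨.inr hvD, h.ne.symm⟩, fun hu => hu.2 rfl⟩
        h.compl_singleton_left_mem_separating
    have hux := D.2.mem_of_notMem_leaf h.neighborSet_left
    simp only [Set.ext_iff, Set.mem_sdiff, Set.mem_insert_iff, Set.mem_singleton_iff,
      Set.mem_compl_iff, Set.mem_univ] at hcompl ⊢
    grind
  calc (dominatingSetsContaining G v).ncard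
      = (Subtype.val '' dominatingSetsContaining G v).ncard :=
        (Set.ncard_image_of_injective _ Subtype.val_injective).symm
    _ ≤ ({{u}ᶜ, {x}ᶜ, Set.univ} : Set (Set V)).ncard := Set.ncard_le_ncard hsubset
    _ ≤ 3 := (Set.ncard_insert_le _ _).trans
        (Nat.add_le_add_right ((Set.ncard_insert_le _ _).trans_eq (by rw [Set.ncard_singleton])) 1)

end Counting

theorem exists_isCycle_length_add_two_mul [Finite V] (h : IsTwinLeaves G u v x)
    {A : {D : Set V // IsDominatingSet G D}} {c : (tarsGraph G).Walk A A} (hc : c.IsCycle)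
    (hv : ∀ D ∈ c.support, v ∈ D.1) (hlen : (dominatingSetsContaining G v).ncard ≤ c.length + 1)
    {k : ℕ} (hk : k ≤ (dominatingSetsSeparating G v u).ncard) :
    ∃ (B : {D : Set V // IsDominatingSet G D}) (d : (tarsGraph G).Walk B B),
      d.IsCycle ∧ d.length = c.length + 2 * k := by
  have hsupport : {D | D ∈ c.support} ⊆ dominatingSetsContaining G v := hv
  have hmissing : (dominatingSetsContaining G v \ {D | D ∈ c.support}).Subsingleton := by
    rw [← Set.ncard_le_one_iff_subsingleton, Set.ncard_sdiff hsupport,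
      ncard_setOf_mem_support_of_isCycle hc]
    omega
  have hux : u ≠ x := (h.adj_left_iff.2 rfl).ne
  have hvx : v ≠ x := (h.adj_right_iff.2 rfl).ne
  obtain ⟨B, hB, huB⟩ : ∃ B ∈ c.support, u ∈ B.1 := by
    by_contra! hB
    have := hmissing (x := ⟨Set.univ, isDominatingSet_univ G⟩)
      ⟨Set.mem_univ v, fun h => hB _ h (Set.mem_univ u)⟩
      (y := ⟨{x}ᶜ, .compl_singleton (h.adj_left_iff.2 rfl).symm⟩) ⟨hvx, fun h => hB _ h hux⟩
    exact (Set.ext_iff.1 (congrArg Subtype.val this) x).1 trivial rfl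
  refine h.rungSystem.exists_isCycle_length_add_two_mul hc hv hB ?_ ?_ ?_
    (by rwa [Nat.card_coe_set_eq])
  · rintro ⟨D, rfl⟩
    exact D.2.2 huB
  · exact fun C hC D hD => Subtype.ext (hmissing ⟨C.2.1, hC⟩ ⟨D.2.1, hD⟩)
  · intro C hC
    have hcard : 3 < (dominatingSetsContaining G v).ncard :=
      hc.three_le_length.trans_lt (ncard_setOf_mem_support_of_isCycle hc ▸
        Set.ncard_lt_ncard (hsupport.ssubset_of_mem_notMem C.2.1 hC))
    obtain ⟨D, hD, hCD⟩ : ∃ D ∈ dominatingSetsSeparating G v u, C.1 ≠ D := by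
      by_contra! hall
      exact hcard.not_ge (h.ncard_containing_le_three fun D hD E hE =>
        (hall D hD).symm.trans (hall E hE))
    obtain ⟨E, hEC, hinter, hunion⟩ := exists_tarsGraph_adj_between hCD
    have hE : E ∈ dominatingSetsSeparating G v u :=
      ⟨hinter ⟨C.2.1, hD.1⟩, fun hu => (hunion hu).elim C.2.2 hD.2⟩
    refine ⟨⟨E, hE⟩, by_contra fun hE' => hEC.ne ?_, hEC⟩
    exact hmissing ⟨hE.1, hE'⟩ ⟨C.2.1, hC⟩

theorem isPancyclic_tarsGraph [Finite V] {U : Type*} [Finite U] {K : SimpleGraph U}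
    (h : IsTwinLeaves G u v x) (hK : IsPancyclic K) (φ : K ↪g tarsGraph G)
    (hφ : Set.range φ = dominatingSetsContaining G v) : IsPancyclic (tarsGraph G) := by
  intro ℓ hℓ hcard
  have hncard : (dominatingSetsContaining G v).ncard = Nat.card U := by
    rw [← hφ, ← Set.image_univ, Set.ncard_image_of_injective _ φ.injective, Set.ncard_univ]
  have hle := h.card_le_ncard_containing_add
  have hlt := h.two_mul_ncard_separating_lt
  have hpos : 0 < (dominatingSetsSeparating G v u).ncard :=
    (Set.ncard_pos (Set.toFinite _)).2 ⟨_, h.compl_singleton_left_mem_separating⟩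
  have hextend (m : ℕ) (hm : 3 ≤ m) (hmn : m ≤ Nat.card U) (hnm : Nat.card U ≤ m + 1) (k : ℕ)
      (hk : k ≤ (dominatingSetsSeparating G v u).ncard) :
      ∃ (B : {D : Set V // IsDominatingSet G D}) (d : (tarsGraph G).Walk B B),
        d.IsCycle ∧ d.length = m + 2 * k := by
    obtain ⟨A, c, hc, rfl, hsupp⟩ := hK.exists_isCycle_of_embedding φ hm hmn
    exact h.exists_isCycle_length_add_two_mul hc (fun D hD => hφ.subset (hsupp D hD))
      (hncard.trans_le hnm) hk
  obtain hℓn | hℓn := le_or_gt ℓ (Nat.card U)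
  · obtain ⟨A, c, hc, hlen, -⟩ := hK.exists_isCycle_of_embedding φ hℓ hℓn
    exact ⟨A, c, hc, hlen⟩
  obtain ⟨k, hk | hk⟩ := Nat.even_or_odd' (ℓ - Nat.card U)
  · obtain rfl : ℓ = Nat.card U + 2 * k := by omega
    exact hextend _ (by omega) le_rfl (Nat.le_succ _) k (by omega)
  obtain hthree | hthree := eq_or_ne (Nat.card U) 3
  · obtain rfl : ℓ = 4 := by omega
    exact exists_isCycle_length_four_tarsGraph
      (h.isDominatingSet_sdiff_right (.compl_singleton (h.adj_left_iff.2 rfl)) fun hu => hu rfl)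
      h.ne (fun hu => hu.1 rfl) fun hv => hv.2 rfl
  · obtain rfl : ℓ = Nat.card U - 1 + 2 * (k + 1) := by omega
    exact hextend _ (by omega) (Nat.sub_le _ _) (by omega) (k + 1) (by omega)

end IsTwinLeaves

end TwinLeaves

theorem mainTheorem4 {V W : Type*} [Finite V] [Finite W]
    (H : SimpleGraph V) (H' : SimpleGraph W) (hB : IsOperationB H H')
    (hH' : IsPancyclic (tarsGraph H')) :
    IsPancyclic (tarsGraph H) := by
  obtain ⟨u, v, x, huv, hu, hv, ⟨e⟩⟩ := hB
  have h : IsTwinLeaves H u v x := ⟨huv, hu, hv⟩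
  let f : H' ↪g H := (Embedding.induce {w | w ≠ v}).comp e.toEmbedding
  have hf : Set.range f = {v}ᶜ := by
    change Set.range (Subtype.val ∘ e) = {v}ᶜ
    rw [e.surjective.range_comp, Subtype.range_coe]
    rfl
  exact h.isPancyclic_tarsGraph hH' (tarsGraphEmbedding f hf) (h.range_tarsGraphEmbedding f hf)
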